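/- Let $A$ be a C*-algebra (not necessarily unital), let $\alpha$ be a $*$-automorphism of $A$, and let $J \subset A$ be a closed two-sided ideal. Let $C^*(\mathbb{Z},A,\alpha)$ be the crossed product, with canonical unitary $u$ (a unitary of $C^*(\mathbb{Z},A,\alpha)$ if $A$ is unital, and of its multiplier algebra in general), so that $uau^* = \alpha(a)$ for all $a \in A$. Let $C_c(\mathbb{Z},A,\alpha)$ be the dense $*$-subalgebra of all finite sums $\sum_{k=-N}^{N} a_k u^k$ with $a_k \in A$, and let $E \colon C^*(\mathbb{Z},A,\alpha) \to A$ be the standard conditional expectation, that is, the continuous linear map with $E\big(\sum_k a_k u^k\big) = a_0$ for all such finite sums. For $n \in \mathbb{Z}$ set \[ J_n = \begin{cases} \bigcap_{i=0}^{n-1} \alpha^i(J) & n > 0,\\ A & n = 0,\\ \bigcap_{i=1}^{|n|} \alpha^{-i}(J) & n < 0. \end{cases} \] Let $C^*(\mathbb{Z},A,\alpha)_J$ be the C*-subalgebra of $C^*(\mathbb{Z},A,\alpha)$ generated by $A$ and $Ju = \{bu : b \in J\}$. Then \[ C^*(\mathbb{Z},A,\alpha)_J = \big\{ x \in C^*(\mathbb{Z},A,\alpha)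 : E(xu^{-n}) \in J_n \text{ for all } n \in \mathbb{Z} \big\}, \] and $C^*(\mathbb{Z},A,\alpha)_J \cap C_c(\mathbb{Z},A,\alpha)$ is dense in $C^*(\mathbb{Z},A,\alpha)_J$. -/

import Mathlib

open scoped ENNReal InnerProductSpace

universe u

/-- A covariant representation of `(A, ℤ, α)` on a nonzero Hilbert space `H`: a
`*`-representation `π` of `A` and a unitary `U` on `H` with `U π(a) U* = π(α(a))`.
Nondegeneracy of `π` is not required, as it does not affect the supremum of the norms over all
covariant representations; nor does the bound on the size of `H` given by its universe. -/
structure CovariantRep {A : Type u} [NonUnitalCStarAlgebra A] (α : A ≃⋆ₐ[ℂ] A) where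
  H : Type u
  [normedAddCommGroup : NormedAddCommGroup H]
  [innerProductSpace : InnerProductSpace ℂ H]
  [completeSpace : CompleteSpace H]
  [nontrivial : Nontrivial H]
  π : A →⋆ₙₐ[ℂ] (H →L[ℂ] H)
  U : unitary (H →L[ℂ] H)
  covariant : ∀ a : A, (U : H →L[ℂ] H) * π a * star (U : H →L[ℂ] H) = π (α a)

attribute [instance] CovariantRep.normedAddCommGroup CovariantRep.innerProductSpace
  CovariantRep.completeSpace CovariantRep.nontrivial

namespace ZCrossedProduct

variable {A : Type u} [NonUnitalCStarAlgebra A] (α : A ≃⋆ₐ[ℂ] A)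

/-- The `ℓ^∞`-product of the C*-algebras `B(H)` over all covariant representations. -/
def Ambient : Type (u + 1) :=
  lp (fun ρ : CovariantRep α => ρ.H →L[ℂ] ρ.H) ∞

/-- The C*-algebra structure of the `ℓ^∞`-product, with pointwise operations and the supremum
norm. -/
noncomputable def lpCStarAlgebra :
    CStarAlgebra (lp (fun ρ : CovariantRep α => ρ.H →L[ℂ] ρ.H) ∞) where

noncomputable instance : CStarAlgebra (Ambient α) := lpCStarAlgebra α

variable {α} in
/-- The component of an element of the ambient algebra in the representation `ρ`. -/
def Ambient.eval (x : Ambient α) (ρ : CovariantRep α) : ρ.H →L[ℂ] ρ.H :=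
  (show lp (fun ρ : CovariantRep α => ρ.H →L[ℂ] ρ.H) ∞ from x) ρ

variable {α} in
theorem Ambient.ext {x y : Ambient α} (h : ∀ ρ, x.eval ρ = y.eval ρ) : x = y :=
  lp.ext (funext h)

variable {α} in
/-- A bounded family of operators, as an element of the ambient algebra. -/
def Ambient.mk (T : ∀ ρ : CovariantRep α, ρ.H →L[ℂ] ρ.H) (C : ℝ) (hT : ∀ ρ, ‖T ρ‖ ≤ C) :
    Ambient α :=
  (⟨T, memℓp_infty ⟨C, by rintro _ ⟨ρ, rfl⟩; exact hT ρ⟩⟩ :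
    lp (fun ρ : CovariantRep α => ρ.H →L[ℂ] ρ.H) ∞)

/-- The universal representation of `A`: `a ↦ (π_ρ(a))_ρ`. -/
noncomputable def ι : A →⋆ₙₐ[ℂ] Ambient α where
  toFun a := Ambient.mk (fun ρ => ρ.π a) ‖a‖
    fun ρ => NonUnitalStarAlgHom.norm_apply_le ρ.π a
  map_smul' c a := Ambient.ext fun ρ => map_smul ρ.π c a
  map_zero' := Ambient.ext fun ρ => map_zero ρ.π
  map_add' a b := Ambient.ext fun ρ => map_add ρ.π a b
  map_mul' a b := Ambient.ext fun ρ => map_mul ρ.π a b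
  map_star' a := Ambient.ext fun ρ => map_star ρ.π a

/-- The canonical unitary `u = (U_ρ)_ρ`. -/
noncomputable def canonicalUnitary : unitary (Ambient α) where
  val := Ambient.mk (fun ρ => ρ.U) 1 fun ρ => (CStarRing.norm_coe_unitary ρ.U).le
  property := Unitary.mem_iff.2
    ⟨Ambient.ext fun ρ => Unitary.coe_star_mul_self ρ.U,
      Ambient.ext fun ρ => Unitary.coe_mul_star_self ρ.U⟩

theorem u_mul_ι (a : A) : (canonicalUnitary α : Ambient α) * ι α a = ι α (α a) * (canonicalUnitary α : Ambient α) := by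
  have h : (canonicalUnitary α : Ambient α) * ι α a * star (canonicalUnitary α : Ambient α) = ι α (α a) := by
    exact Ambient.ext fun ρ => ρ.covariant a
  rw [← h, mul_assoc _ _ (canonicalUnitary α : Ambient α), Unitary.coe_star_mul_self, mul_one]

/-- The `n`-th power of the canonical unitary. -/
noncomputable def uPow (n : ℤ) : Ambient α := ((canonicalUnitary α ^ n : unitary (Ambient α)) : Ambient α)

/-- Evaluation in a representation, as a homomorphism of monoids. -/
def evalHom (ρ : CovariantRep α) : Ambient α →⋆* (ρ.H →L[ℂ] ρ.H) where
  toFun x := x.eval ρ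
  map_one' := rfl
  map_mul' _ _ := rfl
  map_star' _ := rfl

theorem eval_uPow (ρ : CovariantRep α) (k : ℤ) :
    (uPow α k).eval ρ = ((ρ.U ^ k : unitary _) : ρ.H →L[ℂ] ρ.H) := by
  have h := map_zpow (Unitary.map (evalHom α ρ)) (canonicalUnitary α) k
  exact congrArg Subtype.val h

theorem uPow_zero : uPow α 0 = 1 := by simp [uPow]

theorem uPow_one : uPow α 1 = canonicalUnitary α := by simp [uPow]

theorem uPow_mul (m n : ℤ) : uPow α m * uPow α n = uPow α (m + n) := by
  simp [uPow, zpow_add]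

theorem star_uPow (n : ℤ) : star (uPow α n) = uPow α (-n) := by
  rw [uPow, uPow, zpow_neg, ← Unitary.coe_star, Unitary.star_eq_inv]

theorem uPow_mul_ι (n : ℤ) (a : A) : uPow α n * ι α a = ι α ((α ^ n) a) * uPow α n := by
  have inv_case (a : A) : uPow α (-1) * ι α a = ι α (α⁻¹ a) * uPow α (-1) := by
    have h := u_mul_ι α (α⁻¹ a)
    rw [← uPow_one, ← StarAlgEquiv.mul_apply, mul_inv_cancel, StarAlgEquiv.one_apply] at h
    calc uPow α (-1) * ι α a
        = uPow α (-1) * (ι α a * uPow α 1) * uPow α (-1) := by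
          simp only [mul_assoc, uPow_mul]; simp [uPow_zero]
      _ = ι α (α⁻¹ a) * uPow α (-1) := by
          rw [← h, ← mul_assoc, uPow_mul]; simp [uPow_zero]
  induction n generalizing a with
  | zero => simp [uPow_zero]
  | succ n ih =>
    rw [← uPow_mul, mul_assoc, uPow_one, u_mul_ι, ← mul_assoc, ih, mul_assoc, zpow_add_one,
      StarAlgEquiv.mul_apply]
  | pred n ih =>
    rw [sub_eq_add_neg, ← uPow_mul, mul_assoc, inv_case, ← mul_assoc, ih, mul_assoc,
      ← sub_eq_add_neg, zpow_sub_one, StarAlgEquiv.mul_apply]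

/-- The map `(a_k)_k ↦ ∑_k a_k u^k` on finitely supported families. -/
noncomputable def finSumAmbient : (ℤ →₀ A) →ₗ[ℂ] Ambient α :=
  Finsupp.lsum ℂ fun k =>
    (LinearMap.mulRight ℂ (uPow α k)).comp
      ({ toFun := ι α
         map_add' := map_add (ι α)
         map_smul' := fun c a => map_smul (ι α) c a } : A →ₗ[ℂ] Ambient α)

theorem finSumAmbient_single (k : ℤ) (a : A) :
    finSumAmbient α (Finsupp.single k a) = ι α a * uPow α k := by
  simp [finSumAmbient]


section
open scoped ComplexOrder ComplexConjugate

/-- A positive element of a unital C*-algebra attains its norm in a state. -/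
theorem exists_state {B : Type u} [CStarAlgebra B] [Nontrivial B] [PartialOrder B]
    [StarOrderedRing B] (c : B) (hc : 0 ≤ c) : ∃ φ : B →ₚ[ℂ] ℂ, φ 1 = 1 ∧ φ c = ‖c‖ := by
  have hn : ‖c‖ + 1 ≤ ‖c + 1‖ := by
    have h1 : ‖c‖ ∈ spectrum ℝ c := CStarAlgebra.norm_mem_spectrum_of_nonneg
    have h2 : ‖c‖ + 1 ∈ spectrum ℝ (c + 1) := by
      have h := (spectrum.add_mem_add_iff (a := c) (r := ‖c‖) (s := (1 : ℝ))).2 h1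
      rwa [map_one, add_comm 1 c] at h
    exact (le_abs_self _).trans (spectrum.norm_le_norm_of_mem h2)
  have hne : c + 1 ≠ 0 := fun h => by
    rw [h, norm_zero] at hn
    linarith [norm_nonneg c]
  obtain ⟨f, hf1, hf⟩ := exists_dual_vector ℂ (c + 1) (norm_ne_zero_iff.2 hne)
  have hre (a : B) : (f a).re ≤ ‖a‖ :=
    (Complex.re_le_norm _).trans (f.le_of_opNorm_le hf1.le a |>.trans (one_mul _).le)
  have hsum : (f c).re + (f 1).re = ‖c + 1‖ := by
    rw [← Complex.add_re, ← map_add, hf]; simp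
  have hc1 : (f c).re = ‖c‖ := by
    have := hre c; have := hre 1; rw [norm_one] at this; linarith
  have h11 : (f 1).re = 1 := by
    have := hre c; have := hre 1; rw [norm_one] at this; linarith
  let ψ : B →ₗ[ℂ] ℂ :=
    { toFun := fun a => (f a + conj (f (star a))) / 2
      map_add' := fun a b => by simp only [map_add, star_add]; ring
      map_smul' := fun z a => by simp; ring }
  have hψ (a : B) (ha : IsSelfAdjoint a) : ψ a = (f a).re := by
    change (f a + conj (f (star a))) / 2 = _
    rw [ha.star_eq, Complex.add_conj]; push_cast; ring
  refine ⟨PositiveLinearMap.mk₀ ψ fun a ha => ?_, ?_, ?_⟩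
  · rw [hψ a (.of_nonneg ha)]
    have h : ‖algebraMap ℝ B ‖a‖ - a‖ ≤ ‖a‖ := by
      have h0 : 0 ≤ algebraMap ℝ B ‖a‖ - a :=
        sub_nonneg.2 (IsSelfAdjoint.of_nonneg ha).le_algebraMap_norm_self
      rw [CStarAlgebra.norm_le_iff_le_algebraMap _ (norm_nonneg a) h0]
      simpa using ha
    have h' := hre (algebraMap ℝ B ‖a‖ - a)
    have h'' : f (algebraMap ℝ B ‖a‖) = ‖a‖ * f 1 := by
      rw [Algebra.algebraMap_eq_smul_one, ← Complex.coe_smul, map_smul, smul_eq_mul]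
    rw [map_sub, h'', Complex.sub_re, Complex.re_ofReal_mul, h11] at h'
    exact_mod_cast (by linarith : 0 ≤ (f a).re)
  · change ψ 1 = 1
    rw [hψ 1 (.one B), h11]; simp
  · change ψ c = _
    rw [hψ c (.of_nonneg hc), hc1]

end

/-- Every element attains its norm in a vector of some representation. -/
theorem exists_rep {A : Type u} [NonUnitalCStarAlgebra A] (a : A) :
    ∃ (K : Type u) (_ : NormedAddCommGroup K) (_ : InnerProductSpace ℂ K) (_ : CompleteSpace K)
      (σ : A →⋆ₙₐ[ℂ] (K →L[ℂ] K)) (ξ : K), ‖ξ‖ = 1 ∧ ‖σ a ξ‖ = ‖a‖ := by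
  let _ : PartialOrder (Unitization ℂ A) := CStarAlgebra.spectralOrder _
  have _ : StarOrderedRing (Unitization ℂ A) := CStarAlgebra.spectralOrderedRing _
  let b : Unitization ℂ A := a
  obtain ⟨φ, h1, h2⟩ := exists_state (star b * b) (star_mul_self_nonneg b)
  refine ⟨φ.GNS, inferInstance, inferInstance, inferInstance,
    φ.gnsNonUnitalStarAlgHom.comp (Unitization.inrNonUnitalStarAlgHom ℂ A),
    ((φ.toPreGNS 1 : φ.PreGNS) : φ.GNS), ?_, ?_⟩
  · rw [UniformSpace.Completion.norm_coe, φ.preGNS_norm_def]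
    simp [h1]
  · rw [NonUnitalStarAlgHom.comp_apply, φ.gnsNonUnitalStarAlgHom_apply_coe,
      UniformSpace.Completion.norm_coe, φ.preGNS_norm_def]
    have : ‖star b * b‖ = ‖a‖ * ‖a‖ := by
      rw [CStarRing.norm_star_mul_self]; simp [b, Unitization.norm_inr]
    have h3 : φ (star b * b) = ((‖a‖ * ‖a‖ : ℝ) : ℂ) := by rw [h2, this]
    have h4 : φ (star (φ.ofPreGNS (φ.leftMulMapPreGNS b (φ.toPreGNS 1))) *
        φ.ofPreGNS (φ.leftMulMapPreGNS b (φ.toPreGNS 1))) = φ (star b * b) := by simp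
    change √(φ (star (φ.ofPreGNS (φ.leftMulMapPreGNS b (φ.toPreGNS 1))) *
        φ.ofPreGNS (φ.leftMulMapPreGNS b (φ.toPreGNS 1)))).re = ‖a‖
    rw [h4, h3, Complex.ofReal_re, Real.sqrt_mul_self (norm_nonneg a)]

/-- The bilateral shift -/
noncomputable def bshift (K : Type u) [NormedAddCommGroup K] [InnerProductSpace ℂ K] :
    lp (fun _ : ℤ => K) 2 ≃ₗᵢ[ℂ] lp (fun _ : ℤ => K) 2 := 
  have mem (m : ℤ) (x : lp (fun _ : ℤ => K) 2) : Memℓp (fun n => x (n + m) : ∀ _ : ℤ, K) 2 := by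
    have h := (memℓp_gen_iff (by norm_num)).1 (lp.memℓp x)
    exact (memℓp_gen_iff (by norm_num)).2 ((Equiv.addRight m).summable_iff.2 h)
  { toFun := fun x => ⟨_, mem (-1) x⟩
    invFun := fun x => ⟨_, mem 1 x⟩
    map_add' := fun x y => by ext n; rfl
    map_smul' := fun c x => by ext n; rfl
    left_inv := fun x => by ext n; simp
    right_inv := fun x => by ext n; simp
    norm_map' := fun x => by
      simp only [lp.norm_eq_tsum_rpow (p := 2) (by norm_num)]
      congr 1
      exact (Equiv.addRight (-1 : ℤ)).tsum_eq (fun n => ‖x n‖ ^ (2 : ℝ≥0∞).toReal) }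

theorem bshift_apply {K : Type u} [NormedAddCommGroup K] [InnerProductSpace ℂ K]
    (x : lp (fun _ : ℤ => K) 2) (n : ℤ) : bshift K x n = x (n - 1) := rfl
theorem bshift_symm_apply {K : Type u} [NormedAddCommGroup K] [InnerProductSpace ℂ K]
    (x : lp (fun _ : ℤ => K) 2) (n : ℤ) : (bshift K).symm x n = x (n + 1) := rfl


theorem norm_zpow_apply (n : ℤ) (a : A) : ‖(α ^ n) a‖ = ‖a‖ :=
  NonUnitalStarAlgHom.norm_map (α ^ n) (EquivLike.injective (α ^ n)) a

/-- The representation of `A` on `ℓ²(ℤ, K)` given by `(a x)(n) = σ(α^{-n}(a)) x(n)`. -/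
noncomputable def diag {K : Type u} [NormedAddCommGroup K] [InnerProductSpace ℂ K]
    [CompleteSpace K] (σ : A →⋆ₙₐ[ℂ] (K →L[ℂ] K)) :
    A →⋆ₙₐ[ℂ] (lp (fun _ : ℤ => K) 2 →L[ℂ] lp (fun _ : ℤ => K) 2) where
  toFun a := lp.mapCLM 2 (fun n => σ ((α ^ (-n)) a)) (norm_nonneg a) fun n =>
    (NonUnitalStarAlgHom.norm_apply_le σ _).trans (norm_zpow_apply α _ a).le
  map_smul' c a := by ext x n; simp
  map_zero' := by ext x n; simp
  map_add' a b := by ext x n; simp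
  map_mul' a b := by ext x n; simp
  map_star' a := by
    refine (ContinuousLinearMap.eq_adjoint_iff _ _).2 fun x y => ?_
    rw [lp.inner_eq_tsum, lp.inner_eq_tsum]
    congr 1; funext n
    simp only [lp.mapCLM_apply_coe, map_star, ContinuousLinearMap.star_eq_adjoint,
      ContinuousLinearMap.adjoint_inner_left]

/-- The bilateral shift, as a unitary operator. -/
noncomputable def bshiftUnitary (K : Type u) [NormedAddCommGroup K] [InnerProductSpace ℂ K]
    [CompleteSpace K] : unitary (lp (fun _ : ℤ => K) 2 →L[ℂ] lp (fun _ : ℤ => K) 2) :=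
  Unitary.linearIsometryEquiv.symm (bshift K)

theorem bshiftUnitary_zpow_apply {K : Type u} [NormedAddCommGroup K] [InnerProductSpace ℂ K]
    [CompleteSpace K] (k n : ℤ) (x : lp (fun _ : ℤ => K) 2) :
    ((bshiftUnitary K ^ k : unitary _) : lp (fun _ : ℤ => K) 2 →L[ℂ] lp (fun _ : ℤ => K) 2) x n =
      x (n - k) := by
  have h : ((bshiftUnitary K ^ k : unitary _) :
      lp (fun _ : ℤ => K) 2 →L[ℂ] lp (fun _ : ℤ => K) 2) x = (bshift K ^ k) x := by
    rw [bshiftUnitary, ← map_zpow]; rfl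
  rw [h]
  clear h
  induction k generalizing x with
  | zero => simp
  | succ k ih =>
    rw [zpow_add_one]
    refine (ih (bshift K x)).trans ?_
    rw [bshift_apply, sub_sub]
  | pred k ih =>
    rw [zpow_sub_one]
    refine (ih ((bshift K).symm x)).trans ?_
    rw [bshift_symm_apply]
    exact congrArg x (by ring)

/-- The regular covariant representation induced by a representation `σ` of `A`. -/
noncomputable def regularRep {K : Type u} [NormedAddCommGroup K] [InnerProductSpace ℂ K]
    [CompleteSpace K] [Nontrivial K] (σ : A →⋆ₙₐ[ℂ] (K →L[ℂ] K)) : CovariantRep α where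
  H := lp (fun _ : ℤ => K) 2
  nontrivial := by
    obtain ⟨x, hx⟩ := exists_ne (0 : K)
    exact ⟨⟨lp.single 2 0 x, 0, fun h => hx (by simpa using congrArg (fun y => y 0) h)⟩⟩
  π := diag α σ
  U := bshiftUnitary K
  covariant a := by
    have h : (bshiftUnitary K : lp (fun _ : ℤ => K) 2 →L[ℂ] lp (fun _ : ℤ => K) 2) * diag α σ a =
        diag α σ (α a) * (bshiftUnitary K : lp (fun _ : ℤ => K) 2 →L[ℂ] _) := by
      ext x n
      change σ ((α ^ (-(n - 1))) a) (x (n - 1)) = σ ((α ^ (-n)) (α a)) (x (n - 1))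
      rw [neg_sub, sub_eq_neg_add, zpow_add_one, StarAlgEquiv.mul_apply]
    rw [h, mul_assoc]
    exact (congrArg (fun S => diag α σ (α a) * S)
      (Unitary.coe_mul_star_self (bshiftUnitary K))).trans (mul_one _)

theorem norm_apply_zero_le (f : ℤ →₀ A) : ‖f 0‖ ≤ ‖finSumAmbient α f‖ := by
  obtain ⟨K, _, _, _, σ, ξ, hξ, hσ⟩ := exists_rep (f 0)
  have : Nontrivial K := ⟨⟨ξ, 0, fun h => by simp [h] at hξ⟩⟩
  let v : lp (fun _ : ℤ => K) 2 := lp.single 2 0 ξ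
  have hv : ‖v‖ = 1 := by rw [lp.norm_single (by norm_num), hξ]
  let T (g : ℤ →₀ A) : lp (fun _ : ℤ => K) 2 →L[ℂ] lp (fun _ : ℤ => K) 2 :=
    (finSumAmbient α g).eval (regularRep α σ)
  have hadd (g₁ g₂ : ℤ →₀ A) : T (g₁ + g₂) = T g₁ + T g₂ := by
    simp only [T, map_add]; rfl
  have hzero : T 0 = 0 := by
    simp only [T, map_zero]; rfl
  have hsingle (k : ℤ) (a : A) : T (Finsupp.single k a) =
      diag α σ a * ((bshiftUnitary K ^ k : unitary _) : lp (fun _ : ℤ => K) 2 →L[ℂ] _) := by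
    simp only [T, finSumAmbient_single]
    exact congrArg (fun S => diag α σ a * S) (eval_uPow α (regularRep α σ) k)
  have key (g : ℤ →₀ A) : T g v 0 = σ (g 0) ξ := by
    induction g using Finsupp.induction_linear with
    | zero => simp [hzero]
    | add g₁ g₂ h₁ h₂ => rw [hadd, Finsupp.add_apply, map_add, add_apply,
        add_apply, ← h₁, ← h₂, lp.coeFn_add, Pi.add_apply]
    | single k a =>
      rw [hsingle]
      change σ ((α ^ (-0 : ℤ)) a) (((bshiftUnitary K ^ k : unitary _) :
        lp (fun _ : ℤ => K) 2 →L[ℂ] lp (fun _ : ℤ => K) 2) v 0) = _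
      rw [bshiftUnitary_zpow_apply]
      by_cases hk : k = 0
      · subst hk; simp [v]
      · simp [v, hk]
  calc ‖f 0‖ = ‖T f v 0‖ := by rw [key, hσ]
    _ ≤ ‖T f v‖ := lp.norm_apply_le_norm (by norm_num) _ 0
    _ ≤ ‖T f‖ * ‖v‖ := ContinuousLinearMap.le_opNorm _ _
    _ ≤ ‖finSumAmbient α f‖ := by
      rw [hv, mul_one]
      exact lp.norm_apply_le_norm ENNReal.top_ne_zero _ (regularRep α σ)

/-- The set of all finite sums `∑_k a_k u^k`, as a `*`-subalgebra of the ambient algebra. -/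
noncomputable def finSums : NonUnitalStarSubalgebra ℂ (Ambient α) where
  carrier := Set.range (finSumAmbient α)
  add_mem' := by
    rintro _ _ ⟨f, rfl⟩ ⟨g, rfl⟩
    exact ⟨f + g, map_add _ f g⟩
  zero_mem' := ⟨0, map_zero _⟩
  smul_mem' := by
    rintro c _ ⟨f, rfl⟩
    exact ⟨c • f, map_smul _ c f⟩
  mul_mem' := by
    rintro _ _ ⟨f, rfl⟩ ⟨g, rfl⟩
    change _ ∈ LinearMap.range (finSumAmbient α)
    induction f using Finsupp.induction_linear with
    | zero => simp
    | add f₁ f₂ h₁ h₂ => rw [map_add, add_mul]; exact add_mem h₁ h₂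
    | single k a =>
      induction g using Finsupp.induction_linear with
      | zero => simp
      | add g₁ g₂ h₁ h₂ => rw [map_add, mul_add]; exact add_mem h₁ h₂
      | single l b =>
        refine ⟨Finsupp.single (k + l) (a * (α ^ k) b), ?_⟩
        rw [finSumAmbient_single, finSumAmbient_single, finSumAmbient_single, ← uPow_mul, map_mul,
          mul_assoc (ι α a) (uPow α k), ← mul_assoc (uPow α k), uPow_mul_ι]
        simp only [mul_assoc]
  star_mem' := by
    rintro _ ⟨f, rfl⟩
    change _ ∈ LinearMap.range (finSumAmbient α)
    induction f using Finsupp.induction_linear with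
    | zero => simp
    | add f₁ f₂ h₁ h₂ => rw [map_add, star_add]; exact add_mem h₁ h₂
    | single k a =>
      refine ⟨Finsupp.single (-k) ((α ^ (-k)) (star a)), ?_⟩
      rw [finSumAmbient_single, finSumAmbient_single, star_mul, star_uPow, ← map_star (ι α),
        uPow_mul_ι]

end ZCrossedProduct

open ZCrossedProduct

/-- The (full) crossed product `C*(ℤ, A, α)`: the completion of the `*`-algebra of finite sums
`∑_k a_k u^k` in the norm `x ↦ sup_ρ ‖ρ(x)‖`, where `ρ` runs over all covariant representations;
it is realised as the closure of that `*`-algebra in the universal representation.  The unitary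
`u = canonicalUnitary α` multiplies it into itself, and so acts on it as a multiplier. -/
def ZCrossedProduct {A : Type u} [NonUnitalCStarAlgebra A] (α : A ≃⋆ₐ[ℂ] A) : Type (u + 1) :=
  (finSums α).topologicalClosure

noncomputable instance {A : Type u} [NonUnitalCStarAlgebra A] (α : A ≃⋆ₐ[ℂ] A) :
    NonUnitalCStarAlgebra (ZCrossedProduct α) :=
  NonUnitalStarSubalgebra.nonUnitalCStarAlgebra (finSums α).topologicalClosure
    (h_closed := (finSums α).isClosed_topologicalClosure)

namespace ZCrossedProduct

variable {A : Type u} [NonUnitalCStarAlgebra A] (α : A ≃⋆ₐ[ℂ] A)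

/-- The inclusion of `C*(ℤ, A, α)` in the ambient algebra. -/
noncomputable def toAmbient : ZCrossedProduct α →⋆ₙₐ[ℂ] Ambient α :=
  NonUnitalStarSubalgebraClass.subtype (finSums α).topologicalClosure

theorem toAmbient_injective : Function.Injective (toAmbient α) := Subtype.val_injective

theorem norm_toAmbient (x : ZCrossedProduct α) : ‖toAmbient α x‖ = ‖x‖ := rfl

/-- The map `(a_k)_k ↦ ∑_k a_k u^k` from finitely supported families to `C*(ℤ, A, α)`. -/
noncomputable def finSum : (ℤ →₀ A) →ₗ[ℂ] ZCrossedProduct α where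
  toFun f := ⟨finSumAmbient α f, (finSums α).le_topologicalClosure ⟨f, rfl⟩⟩
  map_add' f g := Subtype.ext (map_add (finSumAmbient α) f g)
  map_smul' c f := Subtype.ext (map_smul (finSumAmbient α) c f)

/-- The element `a u^n` of `C*(ℤ, A, α)`. -/
noncomputable def monomial (a : A) (n : ℤ) : ZCrossedProduct α := finSum α (Finsupp.single n a)

theorem toAmbient_monomial (a : A) (n : ℤ) :
    toAmbient α (monomial α a n) = ι α a * uPow α n := finSumAmbient_single α n a

/-- The algebraic crossed product `C_c(ℤ, A, α)`: all finite sums `∑_k a_k u^k`. -/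
noncomputable def algebraic : NonUnitalStarSubalgebra ℂ (ZCrossedProduct α) :=
  (finSums α).comap (toAmbient α)

theorem mem_algebraic_iff {x : ZCrossedProduct α} : x ∈ algebraic α ↔ ∃ f, finSum α f = x := by
  constructor
  · rintro ⟨f, hf⟩
    exact ⟨f, Subtype.ext hf⟩
  · rintro ⟨f, rfl⟩
    exact ⟨f, rfl⟩

variable {α} in
/-- The element `x u^n` of `C*(ℤ, A, α)`, for `x ∈ C*(ℤ, A, α)`. -/
noncomputable def mulUPow (x : ZCrossedProduct α) (n : ℤ) : ZCrossedProduct α :=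
  ⟨toAmbient α x * uPow α n, by
    refine map_mem_closure (f := fun y : Ambient α => y * uPow α n)
      (continuous_id.mul continuous_const) x.2 ?_
    rintro _ ⟨f, rfl⟩
    change _ ∈ LinearMap.range (finSumAmbient α)
    induction f using Finsupp.induction_linear with
    | zero => simp
    | add f₁ f₂ h₁ h₂ => simp only [map_add, add_mul]; exact add_mem h₁ h₂
    | single k a =>
      refine ⟨Finsupp.single (k + n) a, ?_⟩
      simp only [finSumAmbient_single, mul_assoc, uPow_mul]⟩

/-- The standard conditional expectation `E : C*(ℤ, A, α) → A`: the extension by continuity of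
`∑_k a_k u^k ↦ a_0`. -/
noncomputable def condExp : ZCrossedProduct α →L[ℂ] A :=
  (Finsupp.lapply 0 : (ℤ →₀ A) →ₗ[ℂ] A).extendOfNorm (finSum α)

theorem denseRange_finSum : DenseRange (finSum α) := by
  rintro ⟨x, hx⟩
  refine closure_subtype.2 ?_
  refine closure_mono ?_ hx
  rintro _ ⟨f, rfl⟩
  exact ⟨finSum α f, ⟨f, rfl⟩, rfl⟩

theorem condExp_finSum (f : ℤ →₀ A) : condExp α (finSum α f) = f 0 :=
  LinearMap.extendOfNorm_eq (denseRange_finSum α)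
    ⟨1, fun f => by rw [one_mul]; exact norm_apply_zero_le α f⟩ f

/-- The ideals `J_n`: `J_n = ⋂_{0 ≤ i < n} α^i(J)` for `n > 0`, `J_0 = A`, and
`J_n = ⋂_{1 ≤ i ≤ |n|} α^{-i}(J)` for `n < 0`. -/
def coeffIdeal (J : TwoSidedIdeal A) (n : ℤ) : Set A :=
  if 0 < n then ⋂ i ∈ Set.Ico (0 : ℤ) n, (α ^ i) '' (J : Set A)
  else if n = 0 then Set.univ
  else ⋂ i ∈ Set.Icc (1 : ℤ) |n|, (α ^ (-i)) '' (J : Set A)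

/-- `C*(ℤ, A, α)_J`: the C*-subalgebra of `C*(ℤ, A, α)` generated by `A` and `J u`. -/
noncomputable def idealSubalgebra (J : TwoSidedIdeal A) :
    NonUnitalStarSubalgebra ℂ (ZCrossedProduct α) :=
  (NonUnitalStarAlgebra.adjoin ℂ
    (Set.range (fun a : A => monomial α a 0) ∪
      (fun a : A => monomial α a 1) '' (J : Set A))).topologicalClosure

end ZCrossedProduct

/-! Write `E_n(x) = E(x u^{-n})`. The ideals satisfy `J_m α^m(J_n) ⊆ J_{m+n}` and `α^{-m}(J_m^*) ⊆
J_{-m}`, so the finite sums `∑ a_k u^k` with `a_k ∈ J_k` form a `*`-algebra (`idealSums`). It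
contains `A` and `Ju`. Since each `E_n` is continuous and each `J_n` is closed, every element of
`C*(ℤ, A, α)_J` has its coefficients in the `J_n`.

For the converse, two facts are combined. Each `a u^n` with `a ∈ J_n` lies in `C*(ℤ, A, α)_J`: since
`a` is a limit of elements `a (a* a e)`, an element of `J_n ∩ α^n(J)` is a limit of products of an
element of `J_n` and one of `α^n(J)`, which gives an induction for `n ≥ 0`; adjoints give `n < 0`
(`monomial_mem_idealSubalgebra`). Moreover, every `x` is a limit of its Fejér means, which are
finite sums built from the coefficients of `x` (`mem_closure_range_fejerMean`).

The Fejér means are contractions for the universal norm (`norm_fejerMean_le`). With `S` the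
bilateral shift, a covariant representation `(π, U)` on `H` yields `(1 ⊗ π, S ⊗ U)` on `ℓ²(ℤ, H)`.
Compressing to the normalised block `N^{-1/2} ∑_{0 ≤ j < N} δ_j ⊗ H` multiplies the coefficient of
`u^k` by `(1 - |k|/N)⁺`. Thus the Fejér mean, seen in any representation, is a compression of `x`
seen in another one.

Density of the finite sums is immediate, as the generators are themselves finite sums. -/

/-! ### Approximate factorization by functional calculus. -/

/-- In a C*-algebra, `a` is a limit of elements of the form `a (a* a e)`. -/
theorem exists_norm_sub_mul_star_mul_self_mul_lt {A : Type*} [NonUnitalCStarAlgebra A] (a : A)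
    {ε : ℝ} (hε : 0 < ε) : ∃ e : A, ‖a - a * (star a * a * e)‖ < ε := by
  have hb : IsSelfAdjoint (star a * a) := .star_mul_self a
  set b := star a * a with hbdef
  have hpos (t : ℝ) : 0 < (ε ^ 2) ^ 2 + t ^ 2 := by positivity
  -- Chosen so that `1 - t g(t) = ε⁴ / (ε⁴ + t²)`. It is continuous on all of `ℝ` and vanishes at
  -- `0`, so positivity of `b` is never needed.
  let g : ℝ → ℝ := fun t => t / ((ε ^ 2) ^ 2 + t ^ 2)
  have hg : Continuous g := continuous_id.div (by fun_prop) fun t => (hpos t).ne'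
  have hg0 : g 0 = 0 := by simp [g]
  refine ⟨cfcₙ g b, ?_⟩
  have he : star (cfcₙ g b) = cfcₙ g b := (cfcₙ_predicate g b : IsSelfAdjoint _).star_eq
  have h1 : star (a - a * (b * cfcₙ g b)) * (a - a * (b * cfcₙ g b)) =
      b - b * (b * cfcₙ g b) - (cfcₙ g b * b * b - cfcₙ g b * b * (b * (b * cfcₙ g b))) := by
    rw [star_sub, star_mul, star_mul, he, hb.star_eq]
    simp only [sub_mul, mul_sub, mul_assoc, hbdef]
    abel
  have hid : cfcₙ (fun t : ℝ => t) b = b := cfcₙ_id' ℝ b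
  have h2 : b - b * (b * cfcₙ g b) - (cfcₙ g b * b * b - cfcₙ g b * b * (b * (b * cfcₙ g b))) =
      cfcₙ (fun t => t - t * (t * g t) - (g t * t * t - g t * t * (t * (t * g t)))) b := by
    have c (f : ℝ → ℝ) (hf : Continuous f) : ContinuousOn f (quasispectrum ℝ b) := hf.continuousOn
    rw [cfcₙ_sub _ _ (hf := c _ (by fun_prop)) (hg := c _ (by fun_prop))
        (hf0 := by simp) (hg0 := by simp),
      cfcₙ_sub _ _ (hf := c _ (by fun_prop)) (hg := c _ (by fun_prop))
        (hf0 := by simp) (hg0 := by simp),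
      cfcₙ_sub _ _ (hf := c _ (by fun_prop)) (hg := c _ (by fun_prop))
        (hf0 := by simp) (hg0 := by simp)]
    rw [cfcₙ_mul (fun t : ℝ => g t * t) (fun t => t * (t * g t)) (hf := c _ (by fun_prop))
        (hg := c _ (by fun_prop)) (hf0 := by simp) (hg0 := by simp),
      cfcₙ_mul (fun t : ℝ => g t * t) (fun t => t) (hf := c _ (by fun_prop))
        (hg := c _ (by fun_prop)) (hf0 := by simp) (hg0 := by simp),
      cfcₙ_mul (fun t : ℝ => t) (fun t => t * g t) (hf := c _ (by fun_prop))
        (hg := c _ (by fun_prop)) (hf0 := by simp) (hg0 := by simp),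
      cfcₙ_mul (fun t : ℝ => t) g (hf := c _ (by fun_prop)) (hg := c _ hg)
        (hf0 := by simp) (hg0 := hg0),
      cfcₙ_mul g (fun t : ℝ => t) (hf := c _ hg) (hg := c _ (by fun_prop))
        (hf0 := hg0) (hg0 := by simp), hid]
  have h3 : ‖star (a - a * (b * cfcₙ g b)) * (a - a * (b * cfcₙ g b))‖ ≤ ε ^ 2 / 2 := by
    rw [h1, h2]
    refine norm_cfcₙ_le fun t _ => ?_
    have hf : t - t * (t * g t) - (g t * t * t - g t * t * (t * (t * g t))) =
        t * ((ε ^ 2) ^ 2 / ((ε ^ 2) ^ 2 + t ^ 2)) ^ 2 := by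
      have := (hpos t).ne'
      simp only [g]
      field_simp
      ring
    rw [hf, norm_mul, norm_pow, Real.norm_eq_abs, Real.norm_eq_abs,
      abs_of_nonneg (a := (ε ^ 2) ^ 2 / _) (by positivity)]
    have hq : (ε ^ 2) ^ 2 / ((ε ^ 2) ^ 2 + t ^ 2) ≤ 1 := by
      rw [div_le_one (hpos t)]; nlinarith [sq_nonneg t]
    have hq0 : 0 ≤ (ε ^ 2) ^ 2 / ((ε ^ 2) ^ 2 + t ^ 2) := by positivity
    calc |t| * ((ε ^ 2) ^ 2 / ((ε ^ 2) ^ 2 + t ^ 2)) ^ 2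
        ≤ |t| * ((ε ^ 2) ^ 2 / ((ε ^ 2) ^ 2 + t ^ 2)) := by
          gcongr; nlinarith
      _ ≤ ε ^ 2 / 2 := by
          rw [← mul_div_assoc, div_le_iff₀ (hpos t), ← sq_abs t]
          -- This is `2 |t| ε² ≤ ε⁴ + t²`, multiplied by `ε² / 2`.
          nlinarith [mul_nonneg (sq_nonneg ε) (sq_nonneg (|t| - ε ^ 2))]
  rw [CStarRing.norm_star_mul_self] at h3
  nlinarith [norm_nonneg (a - a * (b * cfcₙ g b)), sq_pos_of_pos hε]

/-! ### Closed two-sided ideals. -/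

namespace TwoSidedIdeal

variable {A : Type*} [NonUnitalCStarAlgebra A] {J : TwoSidedIdeal A}

theorem mem_of_forall_exists_norm_sub_lt (hJ : IsClosed (J : Set A)) {a : A}
    (h : ∀ ε > 0, ∃ b ∈ J, ‖a - b‖ < ε) : a ∈ J := by
  refine hJ.closure_subset (Metric.mem_closure_iff.2 fun ε hε => ?_)
  obtain ⟨b, hb, h⟩ := h ε hε
  exact ⟨b, hb, by rwa [dist_eq_norm]⟩

/-- A two-sided ideal of a non-unital ring need not absorb scalars. Here `c • a` is a limit of
products `(c • a) * y`, and the scalar can be moved onto `y`. -/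
theorem smul_mem_of_isClosed (hJ : IsClosed (J : Set A)) (c : ℂ) {a : A} (ha : a ∈ J) :
    c • a ∈ J := by
  refine mem_of_forall_exists_norm_sub_lt hJ fun ε hε => ?_
  obtain ⟨e, he⟩ := exists_norm_sub_mul_star_mul_self_mul_lt (c • a) hε
  refine ⟨_, ?_, he⟩
  rw [smul_mul_assoc, ← mul_smul_comm]
  exact J.mul_mem_right _ _ ha

/-- The approximants of `star a` are `star a * (a * star a * e)`, which contain the factor `a`. -/
theorem star_mem_of_isClosed (hJ : IsClosed (J : Set A)) {a : A} (ha : a ∈ J) :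
    star a ∈ J := by
  refine mem_of_forall_exists_norm_sub_lt hJ fun ε hε => ?_
  obtain ⟨e, he⟩ := exists_norm_sub_mul_star_mul_self_mul_lt (star a) hε
  refine ⟨_, ?_, he⟩
  rw [star_star]
  exact J.mul_mem_left _ _ (J.mul_mem_right _ _ (J.mul_mem_right _ _ ha))

end TwoSidedIdeal

/-! ### The ideals `J_n` and their graded structure. -/

namespace ZCrossedProduct

variable {A : Type u} [NonUnitalCStarAlgebra A] {α : A ≃⋆ₐ[ℂ] A} {J : TwoSidedIdeal A}

theorem zpow_apply_zpow_apply (m n : ℤ) (a : A) : (α ^ m) ((α ^ n) a) = (α ^ (m + n)) a := by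
  rw [zpow_add, StarAlgEquiv.mul_apply]

theorem mem_image_zpow_iff {i : ℤ} {a : A} :
    a ∈ (α ^ i) '' (J : Set A) ↔ (α ^ (-i)) a ∈ J := by
  constructor
  · rintro ⟨b, hb, rfl⟩
    rw [zpow_apply_zpow_apply, neg_add_cancel, zpow_zero]
    exact hb
  · intro h
    refine ⟨_, h, ?_⟩
    rw [zpow_apply_zpow_apply, add_neg_cancel, zpow_zero]
    rfl

/-- A uniform description of the ideals `J_n` for positive and negative `n`. -/
theorem mem_coeffIdeal_iff {n : ℤ} {a : A} : a ∈ coeffIdeal α J n ↔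
    ∀ i : ℤ, (0 ≤ i ∧ i < n ∨ n ≤ i ∧ i < 0) → (α ^ (-i)) a ∈ J := by
  unfold coeffIdeal
  split_ifs with h h'
  · simp only [Set.mem_iInter, mem_image_zpow_iff, Set.mem_Ico]
    exact ⟨fun H i hi => H i (by omega), fun H i hi => H i (by omega)⟩
  · simp only [Set.mem_univ, true_iff]
    intro i hi
    omega
  · simp only [Set.mem_iInter, mem_image_zpow_iff, Set.mem_Icc, neg_neg]
    rw [abs_of_nonpos (by omega)]
    refine ⟨fun H i hi => H (-i) (by omega), fun H i hi => ?_⟩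
    simpa using H (-i) (by omega)

theorem mem_coeffIdeal_zero (a : A) : a ∈ coeffIdeal α J 0 :=
  mem_coeffIdeal_iff.2 fun i hi => by omega

theorem mem_coeffIdeal_one {a : A} : a ∈ coeffIdeal α J 1 ↔ a ∈ J := by
  rw [mem_coeffIdeal_iff]
  refine ⟨fun h => by simpa using h 0 (by omega), fun h i hi => ?_⟩
  obtain rfl : i = 0 := by omega
  simpa using h

/-- An index `i` lying between `0` and `m + n` lies between `0` and `m`, or else `i - m` lies
between `0` and `n`. In the first case the factor `a` is moved into `J`, in the second the factor
`b`. -/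
theorem mul_mem_coeffIdeal {m n : ℤ} {a b : A} (ha : a ∈ coeffIdeal α J m)
    (hb : b ∈ coeffIdeal α J n) : a * (α ^ m) b ∈ coeffIdeal α J (m + n) := by
  rw [mem_coeffIdeal_iff] at *
  intro i hi
  rw [map_mul, zpow_apply_zpow_apply]
  by_cases h : 0 ≤ i ∧ i < m ∨ m ≤ i ∧ i < 0
  · exact J.mul_mem_right _ _ (ha i h)
  · have := hb (i - m) (by omega)
    rw [neg_sub, sub_eq_neg_add] at this
    exact J.mul_mem_left _ _ this

/-- Translation by `m` carries the index interval of `J_{-m}` onto that of `J_m`. -/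
theorem star_mem_coeffIdeal (hJ : IsClosed (J : Set A)) {m : ℤ} {a : A}
    (ha : a ∈ coeffIdeal α J m) : (α ^ (-m)) (star a) ∈ coeffIdeal α J (-m) := by
  rw [mem_coeffIdeal_iff] at *
  intro i hi
  rw [zpow_apply_zpow_apply, map_star]
  have := ha (i + m) (by omega)
  rw [neg_add] at this
  exact TwoSidedIdeal.star_mem_of_isClosed hJ this

theorem zero_mem_coeffIdeal (n : ℤ) : (0 : A) ∈ coeffIdeal α J n :=
  mem_coeffIdeal_iff.2 fun i _ => by rw [map_zero]; exact J.zero_mem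

theorem add_mem_coeffIdeal {n : ℤ} {a b : A} (ha : a ∈ coeffIdeal α J n)
    (hb : b ∈ coeffIdeal α J n) : a + b ∈ coeffIdeal α J n := by
  rw [mem_coeffIdeal_iff] at *
  intro i hi
  rw [map_add]
  exact J.add_mem (ha i hi) (hb i hi)

theorem smul_mem_coeffIdeal (hJ : IsClosed (J : Set A)) {n : ℤ} (c : ℂ) {a : A}
    (ha : a ∈ coeffIdeal α J n) : c • a ∈ coeffIdeal α J n := by
  rw [mem_coeffIdeal_iff] at *
  intro i hi
  rw [map_smul]
  exact TwoSidedIdeal.smul_mem_of_isClosed hJ c (ha i hi)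

theorem isClosed_coeffIdeal (hJ : IsClosed (J : Set A)) (n : ℤ) :
    IsClosed (coeffIdeal α J n) := by
  have : coeffIdeal α J n = ⋂ (i : ℤ) (_ : 0 ≤ i ∧ i < n ∨ n ≤ i ∧ i < 0),
      (α ^ (-i)) ⁻¹' (J : Set A) := by
    ext a
    simp only [mem_coeffIdeal_iff, Set.mem_iInter]
    rfl
  rw [this]
  refine isClosed_biInter fun i _ => hJ.preimage ?_
  exact (AddMonoidHomClass.isometry_of_norm (α ^ (-i)) (norm_zpow_apply α (-i))).continuous

/-! ### Monomials `a u^n` and Fourier coefficients. -/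

theorem monomial_mul_monomial (a b : A) (m n : ℤ) :
    monomial α a m * monomial α b n = monomial α (a * (α ^ m) b) (m + n) := by
  apply toAmbient_injective
  rw [map_mul, toAmbient_monomial, toAmbient_monomial, toAmbient_monomial, ← uPow_mul, map_mul,
    mul_assoc (ι α a) (uPow α m), ← mul_assoc (uPow α m), uPow_mul_ι]
  simp only [mul_assoc]

theorem star_monomial (a : A) (m : ℤ) :
    star (monomial α a m) = monomial α ((α ^ (-m)) (star a)) (-m) := by
  apply toAmbient_injective
  rw [map_star, toAmbient_monomial, toAmbient_monomial, star_mul, star_uPow, ← map_star (ι α),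
    uPow_mul_ι]

theorem monomial_add (a b : A) (n : ℤ) :
    monomial α (a + b) n = monomial α a n + monomial α b n := by
  simp [monomial]

theorem monomial_smul (c : ℂ) (a : A) (n : ℤ) :
    monomial α (c • a) n = c • monomial α a n := by
  rw [monomial, ← Finsupp.smul_single, map_smul]; rfl

theorem norm_monomial_le (a : A) (n : ℤ) : ‖monomial α a n‖ ≤ ‖a‖ := by
  rw [← norm_toAmbient, toAmbient_monomial, uPow, CStarRing.norm_mul_coe_unitary]
  exact NonUnitalStarAlgHom.norm_apply_le (ι α) a

variable (α) in
/-- The map `a ↦ a u^n` as a continuous linear map. -/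
noncomputable def monomialCLM (n : ℤ) : A →L[ℂ] ZCrossedProduct α :=
  LinearMap.mkContinuous
    { toFun := fun a => monomial α a n
      map_add' := fun a b => monomial_add a b n
      map_smul' := fun c a => monomial_smul c a n } 1
    fun a => by rw [one_mul]; exact norm_monomial_le a n

theorem monomialCLM_apply (n : ℤ) (a : A) : monomialCLM α n a = monomial α a n := rfl

variable (α) in
/-- The map `x ↦ x u^n` as a continuous linear map. -/
noncomputable def mulUPowCLM (n : ℤ) : ZCrossedProduct α →L[ℂ] ZCrossedProduct α :=
  LinearMap.mkContinuous
    { toFun := fun x => mulUPow x n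
      map_add' := fun x y => by
        apply toAmbient_injective
        change toAmbient α (x + y) * _ = toAmbient α x * _ + toAmbient α y * _
        rw [map_add, add_mul]
      map_smul' := fun c x => by
        apply toAmbient_injective
        change toAmbient α (c • x) * _ = c • (toAmbient α x * _)
        rw [map_smul, smul_mul_assoc] } 1
    fun x => by
      rw [one_mul]
      change ‖toAmbient α x * uPow α n‖ ≤ _
      rw [uPow, CStarRing.norm_mul_coe_unitary, norm_toAmbient]

variable (α) in
/-- The `n`-th Fourier coefficient `x ↦ E(x u^{-n})`. -/
noncomputable def coeff (n : ℤ) : ZCrossedProduct α →L[ℂ] A :=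
  (condExp α).comp (mulUPowCLM α (-n))

theorem coeff_apply (n : ℤ) (x : ZCrossedProduct α) :
    coeff α n x = condExp α (mulUPow x (-n)) := rfl

theorem coeff_monomial (a : A) (k n : ℤ) :
    coeff α n (monomial α a k) = if k = n then a else 0 := by
  have : mulUPow (monomial α a k) (-n) = finSum α (Finsupp.single (k - n) a) := by
    apply toAmbient_injective
    change toAmbient α (monomial α a k) * uPow α (-n) = toAmbient α (monomial α a (k - n))
    rw [toAmbient_monomial, toAmbient_monomial, mul_assoc, uPow_mul, sub_eq_add_neg]
  rw [coeff_apply, this, condExp_finSum, Finsupp.single_apply]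
  simp [sub_eq_zero]

/-! ### Coefficients of elements of `C*(ℤ, A, α)_J`. -/

variable (α J) in
/-- The finite sums `∑_k a_k u^k` with `a_k ∈ J_k`, as a `*`-subalgebra. -/
noncomputable def idealSums (hJ : IsClosed (J : Set A)) :
    NonUnitalStarSubalgebra ℂ (ZCrossedProduct α) where
  __ := Submodule.span ℂ {x | ∃ n, ∃ a ∈ coeffIdeal α J n, monomial α a n = x}
  mul_mem' := by
    intro x y hx hy
    change _ ∈ Submodule.span ℂ _
    refine Submodule.span_induction₂ (p := fun x y _ _ => x * y ∈ Submodule.span ℂ _)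
      ?_ ?_ ?_ ?_ ?_ ?_ ?_ hx hy
    · rintro _ _ ⟨m, a, ha, rfl⟩ ⟨n, b, hb, rfl⟩
      exact Submodule.subset_span
        ⟨_, _, mul_mem_coeffIdeal ha hb, (monomial_mul_monomial a b m n).symm⟩
    · intro y _; rw [zero_mul]; exact zero_mem _
    · intro y _; rw [mul_zero]; exact zero_mem _
    · intro x y z _ _ _ h h'; rw [add_mul]; exact add_mem h h'
    · intro x y z _ _ _ h h'; rw [mul_add]; exact add_mem h h'
    · intro c x y _ _ h; rw [smul_mul_assoc]; exact Submodule.smul_mem _ c h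
    · intro c x y _ _ h; rw [mul_smul_comm]; exact Submodule.smul_mem _ c h
  star_mem' := by
    intro x hx
    change _ ∈ Submodule.span ℂ _
    refine Submodule.span_induction (p := fun x _ => star x ∈ Submodule.span ℂ _)
      ?_ ?_ ?_ ?_ hx
    · rintro _ ⟨m, a, ha, rfl⟩
      exact Submodule.subset_span ⟨_, _, star_mem_coeffIdeal hJ ha, (star_monomial a m).symm⟩
    · rw [star_zero]; exact zero_mem _
    · intro x y _ _ h h'; rw [star_add]; exact add_mem h h'
    · intro c x _ h; rw [star_smul]; exact Submodule.smul_mem _ _ h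

variable (α J) in
/-- The generators `A ∪ J u` of `C*(ℤ, A, α)_J`. -/
def idealGenerators : Set (ZCrossedProduct α) :=
  Set.range (fun a : A => monomial α a 0) ∪ (fun a : A => monomial α a 1) '' (J : Set A)

theorem adjoin_idealGenerators_le_idealSums (hJ : IsClosed (J : Set A)) :
    NonUnitalStarAlgebra.adjoin ℂ (idealGenerators α J) ≤ idealSums α J hJ := by
  refine NonUnitalStarAlgebra.adjoin_le ?_
  rintro _ (⟨a, rfl⟩ | ⟨a, ha, rfl⟩)
  · exact Submodule.subset_span ⟨0, a, mem_coeffIdeal_zero a, rfl⟩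
  · exact Submodule.subset_span ⟨1, a, mem_coeffIdeal_one.2 ha, rfl⟩

theorem coeff_mem_coeffIdeal_of_mem_idealSums (hJ : IsClosed (J : Set A)) {x : ZCrossedProduct α}
    (hx : x ∈ idealSums α J hJ) (n : ℤ) : coeff α n x ∈ coeffIdeal α J n := by
  refine Submodule.span_induction (p := fun x _ => coeff α n x ∈ coeffIdeal α J n)
    ?_ ?_ ?_ ?_ hx
  · rintro _ ⟨m, a, ha, rfl⟩
    rw [coeff_monomial]
    split_ifs with h
    · exact h ▸ ha
    · exact zero_mem_coeffIdeal n
  · rw [map_zero]; exact zero_mem_coeffIdeal n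
  · intro x y _ _ h h'; rw [map_add]; exact add_mem_coeffIdeal h h'
  · intro c x _ h; rw [map_smul]; exact smul_mem_coeffIdeal hJ c h

theorem coeff_mem_coeffIdeal_of_mem_idealSubalgebra (hJ : IsClosed (J : Set A))
    {x : ZCrossedProduct α} (hx : x ∈ idealSubalgebra α J) (n : ℤ) :
    coeff α n x ∈ coeffIdeal α J n := by
  have hcl : IsClosed (coeff α n ⁻¹' coeffIdeal α J n) :=
    (isClosed_coeffIdeal hJ n).preimage (coeff α n).continuous
  exact closure_minimal (fun y hy => coeff_mem_coeffIdeal_of_mem_idealSums hJ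
    (adjoin_idealGenerators_le_idealSums hJ hy) n) hcl hx

/-! ### Monomials in `C*(ℤ, A, α)_J`, and density of finite sums. -/

theorem isClosed_idealSubalgebra : IsClosed (idealSubalgebra α J : Set (ZCrossedProduct α)) :=
  NonUnitalStarSubalgebra.isClosed_topologicalClosure _

theorem monomial_zero_mem_idealSubalgebra (a : A) : monomial α a 0 ∈ idealSubalgebra α J :=
  NonUnitalStarSubalgebra.le_topologicalClosure _
    (NonUnitalStarAlgebra.subset_adjoin ℂ _ (.inl ⟨a, rfl⟩))

theorem monomial_one_mem_idealSubalgebra {a : A} (ha : a ∈ J) :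
    monomial α a 1 ∈ idealSubalgebra α J :=
  NonUnitalStarSubalgebra.le_topologicalClosure _
    (NonUnitalStarAlgebra.subset_adjoin ℂ _ (.inr ⟨a, ha, rfl⟩))

/-- Induction on `n`. For `a ∈ J_{n+1}` one has `a ∈ J_n` and `α^{-n}(a) ∈ J`, and `a u^{n+1}` is
approximated by `a (a* a e) u^{n+1} = (a u^n) (α^{-n}(a* a e) u)`. The first factor is covered by
the induction hypothesis, the second lies in `Ju`. -/
theorem monomial_natCast_mem_idealSubalgebra (n : ℕ) {a : A} (ha : a ∈ coeffIdeal α J n) :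
    monomial α a n ∈ idealSubalgebra α J := by
  induction n generalizing a with
  | zero => exact monomial_zero_mem_idealSubalgebra a
  | succ n ih =>
    rw [mem_coeffIdeal_iff] at ha
    push_cast at ha ⊢
    refine isClosed_idealSubalgebra.closure_subset (Metric.mem_closure_iff.2 fun ε hε => ?_)
    obtain ⟨e, he⟩ := exists_norm_sub_mul_star_mul_self_mul_lt a hε
    refine ⟨monomial α (a * (star a * a * e)) (n + 1), ?_, ?_⟩
    · have hsplit : monomial α (a * (star a * a * e)) (n + 1) =
          monomial α a n * monomial α ((α ^ (-n : ℤ)) (star a * a * e)) 1 := by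
        rw [monomial_mul_monomial, zpow_apply_zpow_apply, add_neg_cancel, zpow_zero]; rfl
      rw [hsplit]
      refine mul_mem (ih (mem_coeffIdeal_iff.2 fun i hi => ha i (by omega)))
        (monomial_one_mem_idealSubalgebra ?_)
      rw [map_mul, map_mul]
      exact J.mul_mem_right _ _ (J.mul_mem_left _ _ (ha n (by omega)))
    · rw [dist_eq_norm, ← monomialCLM_apply, ← monomialCLM_apply, ← map_sub]
      exact (norm_monomial_le _ _).trans_lt he

/-- The adjoint of `a u^{-k}` is `α^k(a*) u^k`, whose coefficient lies in `J_k`; this reduces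
negative exponents to nonnegative ones. -/
theorem monomial_mem_idealSubalgebra (hJ : IsClosed (J : Set A)) {n : ℤ} {a : A}
    (ha : a ∈ coeffIdeal α J n) : monomial α a n ∈ idealSubalgebra α J := by
  obtain ⟨k, rfl | rfl⟩ := n.eq_nat_or_neg
  · exact monomial_natCast_mem_idealSubalgebra k ha
  · have hs := star_mem_coeffIdeal hJ ha
    rw [neg_neg] at hs
    have h := star_mem (monomial_natCast_mem_idealSubalgebra k hs)
    rwa [star_monomial, ← map_star, star_star, zpow_apply_zpow_apply, neg_add_cancel,
      zpow_zero] at h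

theorem adjoin_idealGenerators_le_algebraic :
    NonUnitalStarAlgebra.adjoin ℂ (idealGenerators α J) ≤ algebraic α := by
  refine NonUnitalStarAlgebra.adjoin_le ?_
  rintro _ (⟨a, rfl⟩ | ⟨a, -, rfl⟩) <;> exact (mem_algebraic_iff α).2 ⟨_, rfl⟩

/-- The `*`-algebra generated by `A` and `Ju` already lies in the intersection, and its closure is
all of `C*(ℤ, A, α)_J`. -/
theorem closure_idealSubalgebra_inter_algebraic :
    closure ((idealSubalgebra α J : Set (ZCrossedProduct α)) ∩ algebraic α) =
      idealSubalgebra α J :=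
  (closure_minimal Set.inter_subset_left isClosed_idealSubalgebra).antisymm
    (closure_mono fun _ hx => ⟨NonUnitalStarSubalgebra.le_topologicalClosure _ hx,
      adjoin_idealGenerators_le_algebraic hx⟩)

end ZCrossedProduct

/-! ### Amplification to `ℓ²(ℤ, H)` and compression to a finite block. -/

namespace ZCrossedProduct

open Filter Topology

section Amplification

variable {H : Type u} [NormedAddCommGroup H] [InnerProductSpace ℂ H]

variable (H) in
/-- The vector `∑_{0 ≤ j < N} δ_j ⊗ h`, as a function of `h`. -/
noncomputable def blockSum (N : ℕ) : H →L[ℂ] lp (fun _ : ℤ => H) 2 :=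
  ∑ j ∈ Finset.Ico (0 : ℤ) N, lp.singleContinuousLinearMap ℂ (fun _ : ℤ => H) 2 j

theorem blockSum_apply (N : ℕ) (h : H) :
    blockSum H N h = ∑ j ∈ Finset.Ico (0 : ℤ) N, lp.single 2 j h := by
  simp [blockSum]

theorem blockSum_apply_apply (N : ℕ) (h : H) (n : ℤ) :
    blockSum H N h n = if n ∈ Finset.Ico (0 : ℤ) N then h else 0 := by
  rw [blockSum_apply, lp.coeFn_sum, Finset.sum_apply]
  simp only [lp.coeFn_single, Pi.single_apply]
  rw [Finset.sum_ite_eq]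

theorem norm_blockSum_apply_sq (N : ℕ) (h : H) : ‖blockSum H N h‖ ^ 2 = N * ‖h‖ ^ 2 := by
  have := lp.norm_sum_single (p := 2) (E := fun _ : ℤ => H) (by norm_num) (fun _ => h)
    (Finset.Ico (0 : ℤ) N)
  rw [← blockSum_apply] at this
  simpa using this

theorem norm_blockSum_le (N : ℕ) : ‖blockSum H N‖ ≤ √N := by
  refine ContinuousLinearMap.opNorm_le_bound _ (Real.sqrt_nonneg _) fun h => ?_
  refine abs_le_of_sq_le_sq' ?_ (by positivity) |>.2
  rw [norm_blockSum_apply_sq, mul_pow, Real.sq_sqrt (Nat.cast_nonneg N)]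

variable [CompleteSpace H]

variable (H) in
/-- The amplification `T ↦ 1 ⊗ T` of operators on `H` to operators on `ℓ²(ℤ, H)`. -/
noncomputable def amplify :
    (H →L[ℂ] H) →⋆ₙₐ[ℂ] (lp (fun _ : ℤ => H) 2 →L[ℂ] lp (fun _ : ℤ => H) 2) :=
  diag (1 : (H →L[ℂ] H) ≃⋆ₐ[ℂ] (H →L[ℂ] H)) (NonUnitalStarAlgHom.id ℂ (H →L[ℂ] H))

theorem amplify_apply (T : H →L[ℂ] H) (x : lp (fun _ : ℤ => H) 2) (n : ℤ) :
    amplify H T x n = T (x n) := by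
  change ((1 : (H →L[ℂ] H) ≃⋆ₐ[ℂ] (H →L[ℂ] H)) ^ (-n)) T (x n) = _
  rw [one_zpow]; rfl

/-- The amplification, as a homomorphism of monoids. -/
noncomputable def amplifyMonoidHom :
    (H →L[ℂ] H) →⋆* (lp (fun _ : ℤ => H) 2 →L[ℂ] lp (fun _ : ℤ => H) 2) where
  toFun := amplify H
  map_one' := by ext x n; rw [amplify_apply]; rfl
  map_mul' := map_mul (amplify H)
  map_star' := map_star (amplify H)

theorem adjoint_blockSum_apply (N : ℕ) (x : lp (fun _ : ℤ => H) 2) :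
    ContinuousLinearMap.adjoint (blockSum H N) x = ∑ j ∈ Finset.Ico (0 : ℤ) N, x j := by
  refine ext_inner_left ℂ fun h => ?_
  rw [ContinuousLinearMap.adjoint_inner_right, blockSum_apply, sum_inner, inner_sum]
  exact Finset.sum_congr rfl fun j _ => lp.inner_single_left j h x

/-- The compression of an operator on `ℓ²(ℤ, H)` to `N⁻¹ᐟ² (∑_{0 ≤ j < N} δ_j) ⊗ H`. -/
noncomputable def compress (N : ℕ)
    (T : lp (fun _ : ℤ => H) 2 →L[ℂ] lp (fun _ : ℤ => H) 2) : H →L[ℂ] H :=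
  (N : ℂ)⁻¹ • (ContinuousLinearMap.adjoint (blockSum H N)).comp (T.comp (blockSum H N))

theorem compress_zero (N : ℕ) : compress (H := H) N 0 = 0 := by
  simp [compress]

theorem compress_add (N : ℕ) (S T : lp (fun _ : ℤ => H) 2 →L[ℂ] lp (fun _ : ℤ => H) 2) :
    compress N (S + T) = compress N S + compress N T := by
  simp [compress, ContinuousLinearMap.add_comp, ContinuousLinearMap.comp_add, smul_add]

theorem norm_compress_le (N : ℕ)
    (T : lp (fun _ : ℤ => H) 2 →L[ℂ] lp (fun _ : ℤ => H) 2) : ‖compress N T‖ ≤ ‖T‖ := by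
  have hV := norm_blockSum_le (H := H) N
  have h1 : ‖(ContinuousLinearMap.adjoint (blockSum H N)).comp (T.comp (blockSum H N))‖ ≤
      √N * (‖T‖ * √N) := by
    refine (ContinuousLinearMap.opNorm_comp_le _ _).trans ?_
    rw [LinearIsometryEquiv.norm_map]
    gcongr
    refine (ContinuousLinearMap.opNorm_comp_le _ _).trans ?_
    gcongr
  have h2 : √(N : ℝ) * (‖T‖ * √N) = N * ‖T‖ := by
    rw [mul_left_comm, Real.mul_self_sqrt (Nat.cast_nonneg N), mul_comm]
  rw [compress, norm_smul, norm_inv, Complex.norm_natCast]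
  calc (N : ℝ)⁻¹ * _ ≤ (N : ℝ)⁻¹ * (N * ‖T‖) := by gcongr; exact h1.trans h2.le
    _ ≤ ‖T‖ := by
      rw [← mul_assoc]
      -- `inv_mul_le_one` also covers `N = 0`, where the inverse is `0` by convention.
      exact mul_le_of_le_one_left (norm_nonneg _) inv_mul_le_one

end Amplification

/-! ### Fejér weights. -/

/-- The Fejér weights `(1 - |k| / N)⁺`. -/
noncomputable def fejerWeight (N : ℕ) (k : ℤ) : ℂ := (N : ℂ)⁻¹ * ((N - k.natAbs : ℕ) : ℂ)

theorem fejerWeight_eq_zero {N : ℕ} {k : ℤ} (hk : k ∉ Finset.Ioo (-N : ℤ) N) :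
    fejerWeight N k = 0 := by
  rw [Finset.mem_Ioo] at hk
  rw [fejerWeight, Nat.sub_eq_zero_of_le (by omega)]
  simp

theorem tendsto_fejerWeight (k : ℤ) : Tendsto (fun N => fejerWeight N k) atTop (𝓝 1) := by
  have h : Tendsto (fun N : ℕ => 1 - (k.natAbs : ℂ) * (N : ℂ)⁻¹) atTop
      (𝓝 (1 - (k.natAbs : ℂ) * 0)) :=
    tendsto_const_nhds.sub (tendsto_const_nhds.mul tendsto_inv_atTop_nhds_zero_nat)
  rw [mul_zero, sub_zero] at h
  refine h.congr' ?_
  -- Beyond `|k|` the truncated subtraction in the weight is a genuine one.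
  filter_upwards [eventually_gt_atTop k.natAbs] with N hN
  have hN0 : (N : ℂ) ≠ 0 := by norm_cast; omega
  rw [fejerWeight, Nat.cast_sub hN.le, mul_sub, inv_mul_cancel₀ hN0, mul_comm]

/-- Counts the overlap of the block `[0, N)` with its translate by `k`; divided by `N` this is the
Fejér weight. -/
theorem card_filter_sub_mem_Ico (N : ℕ) (k : ℤ) :
    ((Finset.Ico (0 : ℤ) N).filter fun i => i - k ∈ Finset.Ico (0 : ℤ) N).card =
      N - k.natAbs := by
  have : (Finset.Ico (0 : ℤ) N).filter (fun i => i - k ∈ Finset.Ico (0 : ℤ) N) =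
      Finset.Ico (max 0 k) (min N (N + k)) := by
    ext i
    simp only [Finset.mem_filter, Finset.mem_Ico]
    omega
  rw [this, Int.card_Ico]
  omega

/-! ### The shifted covariant representation `(1 ⊗ π, S ⊗ U)`. -/

variable {A : Type u} [NonUnitalCStarAlgebra A] {α : A ≃⋆ₐ[ℂ] A}

section Shift

variable {H : Type u} [NormedAddCommGroup H] [InnerProductSpace ℂ H] [CompleteSpace H]

theorem commute_bshiftUnitary_amplify (T : H →L[ℂ] H) :
    Commute (bshiftUnitary H : lp (fun _ : ℤ => H) 2 →L[ℂ] lp (fun _ : ℤ => H) 2)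
      (amplify H T) := by
  ext x n
  change amplify H T x (n - 1) = amplify H T _ n
  rw [amplify_apply, amplify_apply]
  rfl

/-- The unitary `S ⊗ U` on `ℓ²(ℤ, H)`, with `S` the bilateral shift. -/
noncomputable def shiftTensor (U : unitary (H →L[ℂ] H)) :
    unitary (lp (fun _ : ℤ => H) 2 →L[ℂ] lp (fun _ : ℤ => H) 2) :=
  bshiftUnitary H * Unitary.map amplifyMonoidHom U

/-- `S` commutes with every `1 ⊗ T`, so it cancels from the conjugation. This gives the covariance
of `CovariantRep.shift`. -/
theorem shiftTensor_mul_amplify_mul_star (U : unitary (H →L[ℂ] H)) (T : H →L[ℂ] H) :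
    (shiftTensor U : lp (fun _ : ℤ => H) 2 →L[ℂ] lp (fun _ : ℤ => H) 2) * amplify H T *
      star (shiftTensor U : lp (fun _ : ℤ => H) 2 →L[ℂ] lp (fun _ : ℤ => H) 2) =
      amplify H (U * T * star (U : H →L[ℂ] H)) := by
  have hU : (shiftTensor U : lp (fun _ : ℤ => H) 2 →L[ℂ] lp (fun _ : ℤ => H) 2) =
    bshiftUnitary H * amplify H U := rfl
  have hc := (commute_bshiftUnitary_amplify ((U : H →L[ℂ] H) * T * star (U : H →L[ℂ] H))).eq
  calc _ = bshiftUnitary H * amplify H (U * T * star (U : H →L[ℂ] H)) *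
        star (bshiftUnitary H : lp (fun _ : ℤ => H) 2 →L[ℂ] lp (fun _ : ℤ => H) 2) := by
        rw [hU, star_mul, map_mul, map_mul, map_star]
        simp only [mul_assoc]
    _ = _ := by
        rw [hc, mul_assoc]
        exact (congrArg (fun S => amplify H ((U : H →L[ℂ] H) * T * star (U : H →L[ℂ] H)) * S)
          (Unitary.coe_mul_star_self (bshiftUnitary H))).trans (mul_one _)

theorem shiftTensor_zpow_apply (U : unitary (H →L[ℂ] H)) (k n : ℤ)
    (x : lp (fun _ : ℤ => H) 2) :
    ((shiftTensor U ^ k : unitary _) :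
      lp (fun _ : ℤ => H) 2 →L[ℂ] lp (fun _ : ℤ => H) 2) x n =
      ((U ^ k : unitary _) : H →L[ℂ] H) (x (n - k)) := by
  have hc : Commute (bshiftUnitary H) (Unitary.map amplifyMonoidHom U) :=
    Subtype.ext (commute_bshiftUnitary_amplify (U : H →L[ℂ] H)).eq
  have h : shiftTensor U ^ k = Unitary.map amplifyMonoidHom (U ^ k) * bshiftUnitary H ^ k := by
    rw [shiftTensor, hc.mul_zpow, map_zpow, (hc.zpow_zpow k k).eq]
  rw [h]
  change amplify H ((U ^ k : unitary _) : H →L[ℂ] H)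
    (((bshiftUnitary H ^ k : unitary _) :
      lp (fun _ : ℤ => H) 2 →L[ℂ] lp (fun _ : ℤ => H) 2) x) n = _
  rw [amplify_apply, bshiftUnitary_zpow_apply]

/-- `(S ⊗ U)^k` translates the block by `k`, and the adjoint of `blockSum` sums over the original
block. Each of the `N - |k|` sites of overlap (none if `|k| ≥ N`) contributes the same vector `T U^k
h`. -/
theorem compress_amplify_mul_shiftTensor_zpow (N : ℕ) (T : H →L[ℂ] H)
    (U : unitary (H →L[ℂ] H)) (k : ℤ) :
    compress N (amplify H T * ((shiftTensor U ^ k : unitary _) :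
      lp (fun _ : ℤ => H) 2 →L[ℂ] lp (fun _ : ℤ => H) 2)) =
      fejerWeight N k • (T * ((U ^ k : unitary _) : H →L[ℂ] H)) := by
  ext h
  change (N : ℂ)⁻¹ • ContinuousLinearMap.adjoint (blockSum H N) (amplify H T
    (((shiftTensor U ^ k : unitary _) :
      lp (fun _ : ℤ => H) 2 →L[ℂ] lp (fun _ : ℤ => H) 2) (blockSum H N h))) =
    fejerWeight N k • T (((U ^ k : unitary _) : H →L[ℂ] H) h)
  rw [adjoint_blockSum_apply, fejerWeight, mul_smul, ← card_filter_sub_mem_Ico]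
  congr 1
  have (i : ℤ) : amplify H T (((shiftTensor U ^ k : unitary _) :
      lp (fun _ : ℤ => H) 2 →L[ℂ] lp (fun _ : ℤ => H) 2) (blockSum H N h)) i =
      if i - k ∈ Finset.Ico (0 : ℤ) N then T (((U ^ k : unitary _) : H →L[ℂ] H) h) else 0 := by
    rw [amplify_apply, shiftTensor_zpow_apply, blockSum_apply_apply]
    split_ifs
    · rfl
    · rw [map_zero, map_zero]
  simp only [this]
  rw [← Finset.sum_filter, Finset.sum_const, Nat.cast_smul_eq_nsmul]

end Shift

/-- The covariant representation `(1 ⊗ π, S ⊗ U)` on `ℓ²(ℤ, H)`, with `S` the bilateral shift. -/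
noncomputable def CovariantRep.shift (ρ : CovariantRep α) : CovariantRep α where
  -- This space lies in the same universe as `ρ.H`, so the new representation is among those over
  -- which the norm of the crossed product is a supremum.
  H := lp (fun _ : ℤ => ρ.H) 2
  nontrivial := by
    obtain ⟨x, hx⟩ := exists_ne (0 : ρ.H)
    exact ⟨⟨lp.single 2 0 x, 0, fun h => hx (by simpa using congrArg (fun y => y 0) h)⟩⟩
  π := (amplify ρ.H).comp ρ.π
  U := shiftTensor ρ.U
  covariant a := (shiftTensor_mul_amplify_mul_star ρ.U (ρ.π a)).trans
    (congrArg (amplify ρ.H) (ρ.covariant a))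

theorem eval_monomial (a : A) (k : ℤ) (ρ : CovariantRep α) :
    (toAmbient α (monomial α a k)).eval ρ =
      ρ.π a * ((ρ.U ^ k : unitary _) : ρ.H →L[ℂ] ρ.H) := by
  rw [toAmbient_monomial]
  exact congrArg (fun S => ρ.π a * S) (eval_uPow α ρ k)

theorem compress_eval_monomial (N : ℕ) (a : A) (k : ℤ) (ρ : CovariantRep α) :
    compress N ((toAmbient α (monomial α a k)).eval (CovariantRep.shift ρ)) =
      fejerWeight N k • (toAmbient α (monomial α a k)).eval ρ := by
  rw [eval_monomial a k ρ, ← compress_amplify_mul_shiftTensor_zpow]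
  exact congrArg (compress N) (eval_monomial a k (CovariantRep.shift ρ))

/-! ### Fejér means: contractivity and approximation. -/

variable (α) in
/-- The Fejér mean `∑_{|k| < N} (1 - |k| / N) E(x u^{-k}) u^k`. -/
noncomputable def fejerMean (N : ℕ) : ZCrossedProduct α →L[ℂ] ZCrossedProduct α :=
  ∑ k ∈ Finset.Ioo (-N : ℤ) N, fejerWeight N k • (monomialCLM α k).comp (coeff α k)

theorem fejerMean_apply (N : ℕ) (x : ZCrossedProduct α) : fejerMean α N x =
    ∑ k ∈ Finset.Ioo (-N : ℤ) N, fejerWeight N k • monomial α (coeff α k x) k := by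
  simp [fejerMean, monomialCLM_apply]

theorem fejerMean_monomial (N : ℕ) (a : A) (k : ℤ) :
    fejerMean α N (monomial α a k) = fejerWeight N k • monomial α a k := by
  have (l : ℤ) : fejerWeight N l • monomial α (coeff α l (monomial α a k)) l =
      if k = l then fejerWeight N k • monomial α a k else 0 := by
    rw [coeff_monomial]
    split_ifs with h
    · rw [h]
    · rw [← monomialCLM_apply, map_zero, smul_zero]
  simp only [fejerMean_apply, this, Finset.sum_ite_eq]
  split_ifs with h
  · rfl
  -- For `|k| ≥ N` the monomial is not seen by the sum, and its weight vanishes as well.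
  · rw [fejerWeight_eq_zero h, zero_smul]

/-- A property of finite sums follows from the case of monomials. -/
theorem finSum_induction {p : ZCrossedProduct α → Prop} (zero : p 0)
    (add : ∀ x y, p x → p y → p (x + y)) (mono : ∀ a k, p (monomial α a k)) (f : ℤ →₀ A) :
    p (finSum α f) := by
  induction f using Finsupp.induction_linear with
  | zero => rwa [map_zero]
  | add f g hf hg => rw [map_add]; exact add _ _ hf hg
  | single k a => exact mono a k

/-- Both sides are additive, so monomials suffice; on these, each side multiplies by `fejerWeight N
k`. -/
theorem eval_fejerMean_finSum (N : ℕ) (f : ℤ →₀ A) (ρ : CovariantRep α) :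
    (toAmbient α (fejerMean α N (finSum α f))).eval ρ =
      compress N ((toAmbient α (finSum α f)).eval (CovariantRep.shift ρ)) := by
  have hadd (x y : ZCrossedProduct α) (τ : CovariantRep α) :
      (toAmbient α (x + y)).eval τ = (toAmbient α x).eval τ + (toAmbient α y).eval τ := rfl
  have hzero (τ : CovariantRep α) : (toAmbient α 0).eval τ = 0 := rfl
  refine finSum_induction (p := fun x => (toAmbient α (fejerMean α N x)).eval ρ =
      compress N ((toAmbient α x).eval (CovariantRep.shift ρ))) ?_ ?_ ?_ f
  · rw [map_zero, hzero, hzero]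
    exact (compress_zero N).symm
  · intro x y hx hy
    rw [map_add, hadd, hadd, hx, hy]
    exact (compress_add N _ _).symm
  · intro a k
    rw [fejerMean_monomial, compress_eval_monomial]
    rfl

/-- In each `ρ` the Fejér mean of a finite sum is a compression of its image under
`CovariantRep.shift ρ`, so its norm is at most the universal norm; density does the rest. A termwise
estimate would only give a bound growing with `N`. -/
theorem norm_fejerMean_le (N : ℕ) (x : ZCrossedProduct α) : ‖fejerMean α N x‖ ≤ ‖x‖ := by
  refine (denseRange_finSum α).induction_on x
    (isClosed_le (fejerMean α N).continuous.norm continuous_norm) fun f => ?_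
  refine lp.norm_le_of_forall_le (norm_nonneg _) fun ρ => ?_
  have := eval_fejerMean_finSum N f ρ
  refine (congrArg norm this).trans_le ((norm_compress_le N _).trans ?_)
  exact lp.norm_apply_le_norm ENNReal.top_ne_zero _ (CovariantRep.shift ρ)

theorem tendsto_fejerMean_finSum (f : ℤ →₀ A) :
    Tendsto (fun N => fejerMean α N (finSum α f)) atTop (𝓝 (finSum α f)) := by
  refine finSum_induction (p := fun x => Tendsto (fun N => fejerMean α N x) atTop (𝓝 x))
    ?_ ?_ ?_ f
  · simp
  · intro x y hx hy
    simpa using hx.add hy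
  · intro a k
    simpa [fejerMean_monomial] using (tendsto_fejerWeight k).smul_const (monomial α a k)

/-- An `ε/3` argument: convergence holds on the dense set of finite sums, and the Fejér means are
contractions uniformly in `N`. -/
theorem mem_closure_range_fejerMean (x : ZCrossedProduct α) :
    x ∈ closure (Set.range fun N => fejerMean α N x) := by
  refine Metric.mem_closure_range_iff.2 fun ε hε => ?_
  obtain ⟨f, hf⟩ := (denseRange_finSum α).exists_dist_lt x (show 0 < ε / 3 by positivity)
  obtain ⟨N, hN⟩ := ((Metric.tendsto_nhds.1 (tendsto_fejerMean_finSum f)) (ε / 3)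
    (by positivity)).exists
  refine ⟨N, ?_⟩
  replace hN : dist (finSum α f) (fejerMean α N (finSum α f)) < ε / 3 := by rwa [dist_comm]
  have h : dist (fejerMean α N (finSum α f)) (fejerMean α N x) < ε / 3 := by
    rw [dist_comm, dist_eq_norm] at hf
    rw [dist_eq_norm, ← map_sub]
    exact (norm_fejerMean_le N _).trans_lt hf
  have h4 := dist_triangle4 x (finSum α f) (fejerMean α N (finSum α f)) (fejerMean α N x)
  linarith

/-- Each Fejér mean of `x` is a finite linear combination of monomials `E_k(x) u^k` with `E_k(x) ∈
J_k`, hence lies in the closed subalgebra. -/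
theorem mem_idealSubalgebra_of_forall_coeff_mem {J : TwoSidedIdeal A}
    (hJ : IsClosed (J : Set A)) {x : ZCrossedProduct α}
    (hx : ∀ n, coeff α n x ∈ coeffIdeal α J n) : x ∈ idealSubalgebra α J := by
  refine closure_minimal ?_ isClosed_idealSubalgebra (mem_closure_range_fejerMean x)
  rintro _ ⟨N, rfl⟩
  change fejerMean α N x ∈ idealSubalgebra α J
  rw [fejerMean_apply]
  exact sum_mem fun k _ => SMulMemClass.smul_mem _ (monomial_mem_idealSubalgebra hJ (hx k))

end ZCrossedProduct

theorem mainTheorem3 {A : Type u} [NonUnitalCStarAlgebra A] (α : A ≃⋆ₐ[ℂ] A)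
    (J : TwoSidedIdeal A) (hJ : IsClosed (J : Set A)) :
    (ZCrossedProduct.idealSubalgebra α J : Set (ZCrossedProduct α)) =
        {x | ∀ n : ℤ, ZCrossedProduct.condExp α (ZCrossedProduct.mulUPow x (-n)) ∈
          ZCrossedProduct.coeffIdeal α J n} ∧
      closure ((ZCrossedProduct.idealSubalgebra α J : Set (ZCrossedProduct α)) ∩
          (ZCrossedProduct.algebraic α : Set (ZCrossedProduct α))) =
        (ZCrossedProduct.idealSubalgebra α J : Set (ZCrossedProduct α)) :=
  ⟨Set.Subset.antisymm
    (fun _ hx n => coeff_mem_coeffIdeal_of_mem_idealSubalgebra hJ hx n)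
    (fun _ hx => mem_idealSubalgebra_of_forall_coeff_mem hJ hx),
    closure_idealSubalgebra_inter_algebraic⟩
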